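/- Let $n,m\ge 1$ be integers and $\varrho=n/(n+m)$. Let $\mathcal X,\mathcal Y$ be measurable spaces ($\mathcal Y$ with a distinguished element $0$, so that $\delta y$ means $y$ if $\delta=1$ and $0$ if $\delta=0$), let $\{Q_\theta\}_{\theta\in\Theta}$ be any family of probability measures on $\mathcal X\times\mathcal Y$, and let $P_\theta$ be the law of $(X,\delta Y,\delta)$ where $(X,Y)\sim Q_\theta$ and $\delta\sim\mathrm{Bernoulli}(\varrho)$ is independent of $(X,Y)$. Let $\widehat\Theta$ be an action space and $\mathcal L:\widehat\Theta\times\Theta\to[0,\infty)$ a nonnegative loss function. Assume: (i) the experiment is dominated: there is a $\sigma$-finite measure $\mu$ with $P_\theta\ll\mu$ for all $\theta\in\Theta$; (ii) $\widehat\Theta$ is a locally compact Hausdorff space with a countable base (equipped with its Borel $\sigma$-algebra); (iii) for every $\theta\in\Theta$ and every $a\in\mathbb R$ the sublevel set $\{t\in\widehat\Theta:\mathcal L(t,\theta)\le a\}$ is compact. The data $\{(X_i,\delta_iY_i,\delta_i)\}_{i=1}^{n+m}$ are i.i.d. copies of $(X,\delta Y,\delta)\sim P_\theta$, and $N=\sum_{i=1}^{n+m}\delta_i$.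 An estimator $\widehat\theta$ is a possibly randomized one, that is, a Markov kernel from the data space to $\widehat\Theta$; expectations are also over its randomization, and all risks take values in $[0,\infty]$. Then for every $q\in(1/2,1)$: (a) if $\lfloor n+n^q\rfloor\le n+m$, then $$\inf_{\widehat\theta}\sup_\theta\mathbb E_\theta\bigl\{\mathcal L(\widehat\theta,\theta)\mid N=\lfloor n+n^q\rfloor\bigr\}\times\bigl(1-e^{-n^{2q-1}/4}\bigr)\ \le\ \inf_{\widehat\theta}\sup_\theta\mathbb E_\theta\{\mathcal L(\widehat\theta,\theta)\};$$ (b) $$\inf_{\widehat\theta}\sup_\theta\mathbb E_\theta\{\mathcal L(\widehat\theta,\theta)\}\ \le\ \inf_{\widehat\theta}\sup_\theta\mathbb E_\theta\bigl\{\mathcal L(\widehat\theta,\theta)\mid N=\lfloor n-n^q+1\rfloor\bigr\}+\Bigl(\sup_{\widehat\theta,\theta}\bigl[\mathbb E_\theta\{\mathcal L^2(\widehat\theta,\theta)\}\bigr]^{1/2}+1\Bigr)e^{-n^{2q-1}/4}.$$ -/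

import Mathlib

open MeasureTheory ProbabilityTheory
open scoped ENNReal

/-- One observation `(x, δ y, δ)`. -/
abbrev Obs (X Y : Type*) : Type _ := X × Y × Bool

/-- A data set of `n + m` observations. -/
abbrev Sample (n m : ℕ) (X Y : Type*) : Type _ := Fin (n + m) → Obs X Y

/-- The labeling probability `n / (n + m)`, as an element of `[0, 1]`. -/
noncomputable def labelProb (n m : ℕ) : unitInterval :=
  ⟨(n : ℝ) / (n + m), by positivity,
    div_le_one_of_le₀ (le_add_of_nonneg_right (Nat.cast_nonneg m)) (by positivity)⟩

/-- The map `((x, y), δ) ↦ (x, δ y, δ)`. -/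
def observe {X Y : Type*} [Zero Y] (z : (X × Y) × Bool) : Obs X Y :=
  (z.1.1, if z.2 then z.1.2 else 0, z.2)

/-- The law of `(X, δ Y, δ)` when `(X, Y)` has law `Q` and `δ` is Bernoulli with parameter
`n / (n + m)`, independent of `(X, Y)`. -/
noncomputable def obsLaw {X Y : Type*} [MeasurableSpace X] [MeasurableSpace Y] [Zero Y]
    (n m : ℕ) (Q : Measure (X × Y)) : Measure (Obs X Y) :=
  (Q.prod (bernoulliMeasure true false (labelProb n m))).map observe

/-- Random-`N` sampling: the law of `n + m` i.i.d. copies of `(X, δ Y, δ)`. -/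
noncomputable def randomNLaw {X Y : Type*} [MeasurableSpace X] [MeasurableSpace Y] [Zero Y]
    (n m : ℕ) (Q : Measure (X × Y)) : Measure (Sample n m X Y) :=
  Measure.pi fun _ => obsLaw n m Q

/-- `N = ∑ i, δ i`, the number of labeled observations. -/
def numLabeled {X Y : Type*} {n m : ℕ} (s : Sample n m X Y) : ℕ :=
  ∑ i, (s i).2.2.toNat

/-- The conditional law of the data set given `N = k`. -/
noncomputable def condNLaw {X Y : Type*} [MeasurableSpace X] [MeasurableSpace Y] [Zero Y]
    (n m k : ℕ) (Q : Measure (X × Y)) : Measure (Sample n m X Y) :=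
  ProbabilityTheory.cond (randomNLaw n m Q) {s | numLabeled s = k}

/-- A family of laws indexed by a bare set `Θ`, as a kernel: `Θ` carries the discrete
`σ`-algebra, so that no measurability in the parameter is required. -/
def familyKernel {Θ D : Type*} [MeasurableSpace D] (P : Θ → Measure D) : @Kernel Θ D ⊤ _ :=
  @Kernel.mk Θ D ⊤ _ P measurable_from_top

/-- The minimax risk `inf_κ sup_θ E_θ[L(κ, θ)]` of the family of data laws `P` for a nonnegative
loss `L`; estimators `κ` are Markov kernels from the data space to the action space, and the
expectation is also over their randomization. -/
noncomputable def minimax {Θ D A : Type*} [MeasurableSpace D] [MeasurableSpace A]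
    (L : A → Θ → ℝ) (P : Θ → Measure D) : ℝ≥0∞ :=
  @minimaxRisk Θ D A ⊤ _ _ (fun θ a => ENNReal.ofReal (L a θ)) (familyKernel P)

/-- `sup_{κ, θ} (E_θ[L(κ, θ) ^ 2]) ^ (1 / 2)`, over all estimators `κ` and parameters `θ`. -/
noncomputable def supRootMeanSq {Θ D A : Type*} [MeasurableSpace D] [MeasurableSpace A]
    (L : A → Θ → ℝ) (P : Θ → Measure D) : ℝ≥0∞ :=
  ⨆ (κ : Kernel D A) (_ : IsMarkovKernel κ) (θ : Θ),
    (∫⁻ s, ∫⁻ a, ENNReal.ofReal (L a θ ^ 2) ∂(κ s) ∂(P θ)) ^ (1 / 2 : ℝ)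

/-- The family `P` is dominated by a `σ`-finite measure. -/
def IsDominated {Θ D : Type*} [MeasurableSpace D] (P : Θ → Measure D) : Prop :=
  ∃ μ : Measure D, SigmaFinite μ ∧ ∀ θ, P θ ≪ μ

/-! Labels can be thrown away but not created. Conditionally on the set `d` of labeled indices, the
data follow the product law `labeledLaw Q d`, and erasing the labels outside `e ⊆ d` turns this law
into `labeledLaw Q e` (`map_eraseLabels`). Given `N = j`, the set `d` is uniform among `j`-sets, and
a uniform `k`-subset of it is a uniform `k`-set. Hence an estimator meant for `N = k` can be run on
data with `N = j ≥ k` at exactly its `N = k` risk (`levelAvg_thinKernel`).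

For (a), take any estimator for random `N`. With `k` labels at hand, draw `j ≤ k` from the law of
`N` conditioned on `N ≤ k`, thin to `j` labels and apply it. Multiplied by `P(N ≤ k)`, the resulting
risk is the part of the original risk coming from `N ≤ k`.

For (b), take any estimator for `N = k` and thin to `k` labels whenever `N ≥ k`. The event `N < k`
costs at most the root mean square of the loss times `P(N < k) ^ (1 / 2)`, by Cauchy-Schwarz.

Chernoff bounds for the binomial law of `N`, whose mean is `n`, control both probabilities.
Estimators are transformed one at a time, so no infimum has to be attained. -/

/-! ### Label sets and erasure of labels -/

/-- The set of labeled indices of a data set. -/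
def labels {ι X Y : Type*} [Fintype ι] (s : ι → Obs X Y) : Finset ι := {i | (s i).2.2 = true}

lemma measurable_labels {ι X Y : Type*} [Fintype ι] [DecidableEq ι] [MeasurableSpace X] [MeasurableSpace Y] :
    Measurable[_, ⊤] (labels : (ι → Obs X Y) → Finset ι) := by
  refine @measurable_to_countable' (Finset ι) _ ⊤ _ _ _ fun d => ?_
  have : (labels ⁻¹' {d} : Set (ι → Obs X Y))
      = ⋂ i, (fun s : ι → Obs X Y => (s i).2.2) ⁻¹' {decide (i ∈ d)} := by
    ext s
    simp only [Set.mem_preimage, Set.mem_singleton_iff, labels, Finset.ext_iff, Finset.mem_filter,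
      Finset.mem_univ, true_and, Set.mem_iInter]
    refine forall_congr' fun i => ?_
    by_cases h : i ∈ d <;> simp [h]
  rw [this]
  exact MeasurableSet.iInter fun i => (measurable_pi_apply i).snd.snd (measurableSet_singleton _)

lemma measurableSet_labels_mem {ι X Y : Type*} [Fintype ι] [DecidableEq ι] [MeasurableSpace X] [MeasurableSpace Y]
    (S : Set (Finset ι)) :
    MeasurableSet {s : ι → Obs X Y | labels s ∈ S} :=
  measurable_labels (MeasurableSpace.measurableSet_top : MeasurableSet[⊤] S)

lemma numLabeled_eq {X Y : Type*} {n m : ℕ} (s : Sample n m X Y) : numLabeled s = (labels s).card := by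
  simp only [numLabeled, labels, Finset.card_filter]
  refine Finset.sum_congr rfl fun i _ => ?_
  cases (s i).2.2 <;> rfl

/-- Erase all labels outside of `e`. -/
def eraseLabels {ι X Y : Type*} [DecidableEq ι] [Zero Y] (e : Finset ι) (s : ι → Obs X Y) : ι → Obs X Y :=
  fun i => if i ∈ e then s i else ((s i).1, 0, false)

lemma measurable_eraseLabels {ι X Y : Type*} [DecidableEq ι] [MeasurableSpace X]
    [MeasurableSpace Y] [Zero Y] (e : Finset ι) :
    Measurable (eraseLabels e : (ι → Obs X Y) → ι → Obs X Y) := by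
  refine measurable_pi_lambda _ fun i => ?_
  unfold eraseLabels
  by_cases h : i ∈ e <;> simp only [h, if_true, if_false] <;> fun_prop

/-! ### The sampling law as a mixture over label sets -/

section Mixture

variable {ι X Y : Type*} [Fintype ι] [DecidableEq ι] [MeasurableSpace X] [MeasurableSpace Y] [Zero Y]

/-- The law of one observation whose label indicator is the constant `b`. -/
noncomputable def singleLaw (Q : Measure (X × Y)) (b : Bool) : Measure (Obs X Y) :=
  Q.map fun z => observe (z, b)

/-- The law of a data set whose set of labeled indices is the constant `d`. -/
noncomputable def labeledLaw (Q : Measure (X × Y)) (d : Finset ι) : Measure (ι → Obs X Y) :=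
  Measure.pi fun i => singleLaw Q (decide (i ∈ d))

lemma measurable_observe : Measurable (observe : (X × Y) × Bool → Obs X Y) := by
  unfold observe
  refine measurable_fst.fst.prodMk (Measurable.prodMk ?_ measurable_snd)
  exact Measurable.ite (measurable_snd (measurableSet_singleton true)) measurable_fst.snd
    measurable_const

lemma measurable_observe_left (b : Bool) : Measurable fun z : X × Y => observe (z, b) :=
  measurable_observe.comp (measurable_id.prodMk measurable_const)

instance (Q : Measure (X × Y)) [IsProbabilityMeasure Q] (b : Bool) :
    IsProbabilityMeasure (singleLaw Q b) :=
  Measure.isProbabilityMeasure_map (measurable_observe_left b).aemeasurable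

instance (Q : Measure (X × Y)) [IsProbabilityMeasure Q] (d : Finset ι) :
    IsProbabilityMeasure (labeledLaw Q d) := by
  unfold labeledLaw; infer_instance

/-- The probability of being labeled, in `[0, ∞]`. -/
noncomputable def labelMass (n m : ℕ) : ℝ≥0∞ := (unitInterval.toNNReal (labelProb n m) : ℝ≥0∞)

/-- The probability of being unlabeled, in `[0, ∞]`. -/
noncomputable def unlabelMass (n m : ℕ) : ℝ≥0∞ :=
  (unitInterval.toNNReal (unitInterval.symm (labelProb n m)) : ℝ≥0∞)

lemma obsLaw_eq (n m : ℕ) (Q : Measure (X × Y)) [IsProbabilityMeasure Q] :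
    obsLaw n m Q = labelMass n m • singleLaw Q true + unlabelMass n m • singleLaw Q false := by
  unfold obsLaw singleLaw labelMass unlabelMass
  rw [bernoulliMeasure_def]
  ext s hs
  have h := measurable_observe (X := X) (Y := Y) hs
  have key (b : Bool) : (Q.prod (Measure.dirac b)) (observe ⁻¹' s)
      = Q ((fun z => observe (z, b)) ⁻¹' s) := by
    rw [Measure.prod_dirac, Measure.map_apply (by fun_prop) h]; rfl
  rw [Measure.map_apply measurable_observe hs, Measure.prod_add]
  simp only [← ENNReal.smul_def, Measure.add_apply, Measure.smul_apply, Measure.prod_smul_right]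
  rw [Measure.map_apply (measurable_observe_left _) hs,
    Measure.map_apply (measurable_observe_left _) hs, key, key]

instance (n m : ℕ) (Q : Measure (X × Y)) [IsProbabilityMeasure Q] :
    IsProbabilityMeasure (obsLaw n m Q) :=
  Measure.isProbabilityMeasure_map measurable_observe.aemeasurable

instance (n m : ℕ) (Q : Measure (X × Y)) [IsProbabilityMeasure Q] :
    IsProbabilityMeasure (randomNLaw n m Q) := by
  unfold randomNLaw; infer_instance

/-- On boxes, the product of two-term sums from `obsLaw_eq` expands over the subsets `d` of indices
that pick the labeled term, and boxes determine a product measure. -/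
lemma randomNLaw_eq (n m : ℕ) (Q : Measure (X × Y)) [IsProbabilityMeasure Q] :
    randomNLaw n m Q = ∑ d : Finset (Fin (n + m)),
      (labelMass n m ^ d.card * unlabelMass n m ^ (n + m - d.card)) • labeledLaw Q d := by
  unfold randomNLaw
  refine Measure.pi_eq fun s hs => ?_
  simp only [Measure.finsetSum_apply, Measure.smul_apply, smul_eq_mul, labeledLaw,
    Measure.pi_pi, obsLaw_eq, Measure.add_apply]
  rw [Fintype.prod_add]
  refine Finset.sum_congr rfl fun d _ => ?_
  rw [Finset.prod_mul_distrib, Finset.prod_mul_distrib, Finset.prod_const, Finset.prod_const,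
    Finset.card_compl, Fintype.card_fin, ← Finset.prod_mul_prod_compl d]
  have h1 : ∏ i ∈ d, (singleLaw Q (decide (i ∈ d))) (s i) = ∏ i ∈ d, (singleLaw Q true) (s i) :=
    Finset.prod_congr rfl fun i hi => by simp [hi]
  have h2 : ∏ i ∈ dᶜ, (singleLaw Q (decide (i ∈ d))) (s i)
      = ∏ i ∈ dᶜ, (singleLaw Q false) (s i) :=
    Finset.prod_congr rfl fun i hi => by simp [Finset.mem_compl.1 hi]
  rw [h1, h2]; ring

lemma labels_ae (Q : Measure (X × Y)) [IsProbabilityMeasure Q] (d : Finset ι) :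
    ∀ᵐ s ∂labeledLaw Q d, labels s = d := by
  have h (i : ι) : ∀ᵐ s ∂labeledLaw Q d, (s i).2.2 = decide (i ∈ d) := by
    refine (Measure.quasiMeasurePreserving_eval
      (fun i => singleLaw Q (decide (i ∈ d))) i).ae (p := fun o => o.2.2 = decide (i ∈ d)) ?_
    unfold singleLaw
    have hset : MeasurableSet {o : Obs X Y | o.2.2 = decide (i ∈ d)} :=
      (measurable_snd.snd : Measurable fun o : Obs X Y => o.2.2) (measurableSet_singleton _)
    exact (ae_map_iff (measurable_observe_left _).aemeasurable hset).2
      (Filter.Eventually.of_forall fun _ => rfl)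
  filter_upwards [ae_all_iff.2 h] with s hs
  ext i
  simp [labels, hs]

/-- Erasure acts coordinatewise, so it suffices to look at one factor. Inclusion is needed because a
coordinate kept in `e` must already be labeled. -/
lemma map_eraseLabels (Q : Measure (X × Y)) [IsProbabilityMeasure Q] {d e : Finset ι}
    (h : e ⊆ d) : (labeledLaw Q d).map (eraseLabels e) = labeledLaw Q e := by
  unfold labeledLaw
  have hm (i : ι) : Measurable fun o : Obs X Y => if i ∈ e then o else (o.1, 0, false) := by
    by_cases h : i ∈ e <;> simp only [h, if_true, if_false] <;> fun_prop
  have hs (i : ι) : (singleLaw Q (decide (i ∈ d))).map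
      (fun o : Obs X Y => if i ∈ e then o else (o.1, 0, false))
      = singleLaw Q (decide (i ∈ e)) := by
    unfold singleLaw
    rw [Measure.map_map (hm i) (measurable_observe_left _)]
    by_cases hi : i ∈ e
    · simp [hi, h hi, Function.comp_def]
    · simp [hi, Function.comp_def, observe]
  have : ∀ i, IsProbabilityMeasure ((singleLaw Q (decide (i ∈ d))).map
      (fun o : Obs X Y => if i ∈ e then o else (o.1, 0, false))) := fun i =>
    Measure.isProbabilityMeasure_map (hm i).aemeasurable
  have key := Measure.pi_map_pi (μ := fun i => singleLaw Q (decide (i ∈ d)))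
    (f := fun i (o : Obs X Y) => if i ∈ e then o else (o.1, 0, false))
    (fun i => (hm i).aemeasurable)
  simp only [hs] at key
  exact key

end Mixture

/-! ### Chernoff bounds for the binomial distribution -/

/-- The mass that the binomial distribution with parameters `M` and `p` gives to `k`. -/
noncomputable def binomialMass (M : ℕ) (p : ℝ) (k : ℕ) : ℝ :=
  M.choose k * (p ^ k * (1 - p) ^ (M - k))

lemma binomialMass_nonneg {M : ℕ} {p : ℝ} (h0 : 0 ≤ p) (h1 : p ≤ 1) (k : ℕ) :
    0 ≤ binomialMass M p k := by
  have := sub_nonneg.2 h1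
  unfold binomialMass; positivity

/-- The moment generating function, read off from the binomial theorem. -/
lemma sum_binomialMass_mul_exp (M : ℕ) (p l : ℝ) :
    ∑ k ∈ Finset.range (M + 1), binomialMass M p k * Real.exp (l * k)
      = (1 + p * (Real.exp l - 1)) ^ M := by
  rw [show 1 + p * (Real.exp l - 1) = p * Real.exp l + (1 - p) by ring, add_pow]
  refine Finset.sum_congr rfl fun k _ => ?_
  rw [mul_comm l, Real.exp_nat_mul, mul_pow, binomialMass]; ring

lemma sum_binomialMass (M : ℕ) (p : ℝ) :
    ∑ k ∈ Finset.range (M + 1), binomialMass M p k = 1 := by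
  simpa using sum_binomialMass_mul_exp M p 0

/-- The exponential Markov inequality for the binomial distribution. -/
lemma sum_binomialMass_filter_le {M : ℕ} {p : ℝ} (h0 : 0 ≤ p) (h1 : p ≤ 1) (l a : ℝ)
    (S : ℕ → Prop) [DecidablePred S] (hS : ∀ k, S k → a ≤ l * k) :
    ∑ k ∈ Finset.range (M + 1) with S k, binomialMass M p k
      ≤ Real.exp (M * p * (Real.exp l - 1) - a) := by
  have hb := binomialMass_nonneg (M := M) h0 h1
  calc ∑ k ∈ Finset.range (M + 1) with S k, binomialMass M p k
      ≤ ∑ k ∈ Finset.range (M + 1) with S k,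
          binomialMass M p k * Real.exp (l * k) * Real.exp (-a) := by
        refine Finset.sum_le_sum fun k hk => ?_
        rw [mul_assoc, ← Real.exp_add]
        refine le_mul_of_one_le_right (hb k) (Real.one_le_exp ?_)
        have := hS k (Finset.mem_filter.1 hk).2
        linarith
    _ ≤ ∑ k ∈ Finset.range (M + 1), binomialMass M p k * Real.exp (l * k) * Real.exp (-a) :=
        Finset.sum_le_sum_of_subset_of_nonneg (Finset.filter_subset _ _) fun k _ _ =>
          mul_nonneg (mul_nonneg (hb k) (Real.exp_pos _).le) (Real.exp_pos _).le
    _ = (1 + p * (Real.exp l - 1)) ^ M * Real.exp (-a) := by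
        rw [← Finset.sum_mul, sum_binomialMass_mul_exp]
    _ ≤ Real.exp (p * (Real.exp l - 1)) ^ M * Real.exp (-a) := by
        refine mul_le_mul_of_nonneg_right (pow_le_pow_left₀ ?_ ?_ _) (Real.exp_pos _).le
        · nlinarith [Real.exp_pos l]
        · linarith [Real.add_one_le_exp (p * (Real.exp l - 1))]
    _ = Real.exp (M * p * (Real.exp l - 1) - a) := by
        rw [← Real.exp_nat_mul, ← Real.exp_add]; ring_nf

lemma exp_neg_le_quadratic {x : ℝ} (hx : 0 ≤ x) : Real.exp (-x) ≤ 1 - x + x ^ 2 / 2 := by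
  rw [Real.exp_neg, inv_le_iff_one_le_mul₀ (Real.exp_pos x)]
  have h := Real.quadratic_le_exp_of_nonneg hx
  have h' : 0 ≤ 1 - x + x ^ 2 / 2 := by nlinarith [sq_nonneg (x - 1)]
  -- `(1 - x + x ^ 2 / 2) * (1 + x + x ^ 2 / 2) = 1 + x ^ 4 / 4`.
  nlinarith [mul_le_mul_of_nonneg_left h h', sq_nonneg (x ^ 2)]

lemma exp_le_one_add_add_sq {x : ℝ} (h0 : 0 ≤ x) (hx : x ≤ 1) : Real.exp x ≤ 1 + x + x ^ 2 := by
  have h := Real.abs_exp_sub_one_sub_id_le (abs_le.2 ⟨by linarith, hx⟩)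
  linarith [(abs_le.1 h).2]

/-- A lower tail bound for the binomial distribution with mean `c`. -/
lemma binomialMass_lower_tail {M : ℕ} {p c t : ℝ} (h0 : 0 ≤ p) (h1 : p ≤ 1) (hc : 0 < c)
    (hM : M * p = c) (ht : 0 ≤ t) (S : ℕ → Prop) [DecidablePred S]
    (hS : ∀ k, S k → (k : ℝ) ≤ c - t) :
    ∑ k ∈ Finset.range (M + 1) with S k, binomialMass M p k ≤ Real.exp (-(t ^ 2 / (2 * c))) := by
  -- With `l = -u`, the quadratic bound on the exponential makes the exponent at most `c * u ^ 2 / 2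
  -- - u * t`, which is minimal at `u = t / c`.
  refine (sum_binomialMass_filter_le h0 h1 (-(t / c)) (-(t / c) * (c - t)) S fun k hk => ?_).trans
    (Real.exp_le_exp.2 ?_)
  · exact mul_le_mul_of_nonpos_left (hS k hk) (by have : 0 ≤ t / c := by positivity
                                                  linarith)
  · have h := exp_neg_le_quadratic (x := t / c) (by positivity)
    rw [hM]
    calc c * (Real.exp (-(t / c)) - 1) - -(t / c) * (c - t)
        ≤ c * ((1 - t / c + (t / c) ^ 2 / 2) - 1) - -(t / c) * (c - t) := by gcongr
      _ = -(t ^ 2 / (2 * c)) := by field_simp; ring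

/-- An upper tail bound for the binomial distribution with mean `c`. -/
lemma binomialMass_upper_tail {M : ℕ} {p c t : ℝ} (h0 : 0 ≤ p) (h1 : p ≤ 1) (hc : 0 < c)
    (hM : M * p = c) (ht : 0 ≤ t) (htc : t ≤ c) (S : ℕ → Prop) [DecidablePred S]
    (hS : ∀ k, S k → c + t ≤ k) :
    ∑ k ∈ Finset.range (M + 1) with S k, binomialMass M p k ≤ Real.exp (-(t ^ 2 / (4 * c))) := by
  -- Here the exponent is at most `c * l ^ 2 - l * t`, minimal at `l = t / (2 * c)`; `t ≤ c` keeps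
  -- `l ≤ 1`, as the bound on `exp l` requires.
  refine (sum_binomialMass_filter_le h0 h1 (t / (2 * c)) (t / (2 * c) * (c + t)) S
    fun k hk => ?_).trans (Real.exp_le_exp.2 ?_)
  · exact mul_le_mul_of_nonneg_left (hS k hk) (by positivity)
  · have h := exp_le_one_add_add_sq (x := t / (2 * c)) (by positivity)
      ((div_le_one (by positivity)).2 (by linarith))
    rw [hM]
    calc c * (Real.exp (t / (2 * c)) - 1) - t / (2 * c) * (c + t)
        ≤ c * ((1 + t / (2 * c) + (t / (2 * c)) ^ 2) - 1) - t / (2 * c) * (c + t) := by gcongr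
      _ = -(t ^ 2 / (4 * c)) := by field_simp; ring

/-! ### Uniform subsets of uniform subsets -/

/-- Averages over the sets of a given cardinality. -/
noncomputable def levelAvg {ι : Type*} [Fintype ι] (f : Finset ι → ℝ≥0∞) (k : ℕ) : ℝ≥0∞ :=
  ((Fintype.card ι).choose k : ℝ≥0∞)⁻¹ * ∑ d ∈ Finset.powersetCard k Finset.univ, f d

lemma card_filter_subset_powersetCard {ι : Type*} [Fintype ι] [DecidableEq ι] (e : Finset ι)
    (j : ℕ) (h : e.card ≤ j) :
    ({d ∈ Finset.powersetCard j (Finset.univ : Finset ι) | e ⊆ d}).card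
      = (Fintype.card ι - e.card).choose (j - e.card) := by
  rw [← Finset.card_compl, ← Finset.card_powersetCard]
  refine Finset.card_nbij' (fun d => d \ e) (fun d => d ∪ e) ?_ ?_ ?_ ?_
  · intro d hd
    simp only [Finset.coe_filter, Finset.mem_powersetCard, Finset.subset_univ, true_and,
      Set.mem_ofPred_eq] at hd
    simp only [Finset.mem_coe, Finset.mem_powersetCard]
    refine ⟨fun i hi => ?_, by rw [Finset.card_sdiff_of_subset hd.2, hd.1]⟩
    simp at hi ⊢; exact hi.2
  · intro d hd
    simp only [Finset.mem_coe, Finset.mem_powersetCard] at hd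
    simp only [Finset.coe_filter, Finset.mem_powersetCard, Finset.subset_univ, true_and,
      Set.mem_ofPred_eq, Finset.subset_union_right, and_true]
    have hdis : Disjoint d e := (Finset.subset_compl_iff_disjoint_right.1 hd.1)
    rw [Finset.card_union_of_disjoint hdis]; omega
  · intro d hd
    simp only [Finset.coe_filter, Set.mem_ofPred_eq] at hd
    exact Finset.sdiff_union_of_subset hd.2
  · intro d hd
    simp only [Finset.mem_coe, Finset.mem_powersetCard] at hd
    exact Finset.union_sdiff_cancel_right (Finset.subset_compl_iff_disjoint_right.1 hd.1)

/-- A uniform `k`-subset of a uniform `j`-subset is a uniform `k`-subset. -/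
lemma levelAvg_levelAvg_subset {ι : Type*} [Fintype ι] [DecidableEq ι] (f : Finset ι → ℝ≥0∞)
    {j k : ℕ} (hkj : k ≤ j) (hj : j ≤ Fintype.card ι) :
    levelAvg (fun d => ∑ e ∈ Finset.powersetCard k d, (d.card.choose k : ℝ≥0∞)⁻¹ * f e) j
      = levelAvg f k := by
  unfold levelAvg
  set M := Fintype.card ι
  have h1 : ∑ d ∈ Finset.powersetCard j (Finset.univ : Finset ι),
      ∑ e ∈ Finset.powersetCard k d, (d.card.choose k : ℝ≥0∞)⁻¹ * f e
      = ∑ d ∈ Finset.powersetCard j (Finset.univ : Finset ι),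
      ∑ e ∈ Finset.powersetCard k (Finset.univ : Finset ι) with e ⊆ d,
        (j.choose k : ℝ≥0∞)⁻¹ * f e := by
    refine Finset.sum_congr rfl fun d hd => ?_
    rw [(Finset.mem_powersetCard.1 hd).2]
    refine Finset.sum_congr ?_ fun _ _ => rfl
    ext e; simp [Finset.mem_powersetCard, and_comm]
  rw [h1]
  simp_rw [Finset.sum_filter]
  rw [Finset.sum_comm, Finset.mul_sum, Finset.mul_sum]
  refine Finset.sum_congr rfl fun e he => ?_
  have hek := (Finset.mem_powersetCard.1 he).2
  rw [← Finset.sum_filter, Finset.sum_const, card_filter_subset_powersetCard e j (hek ▸ hkj), hek,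
    nsmul_eq_mul]
  -- Both sides count the pairs `e ⊆ d` with `e.card = k` and `d.card = j`.
  have hch : (M.choose j : ℝ≥0∞) * (j.choose k) = M.choose k * ((M - k).choose (j - k) : ℕ) := by
    exact_mod_cast Nat.choose_mul hkj
  have n1 : (M.choose j : ℝ≥0∞) ≠ 0 := by exact_mod_cast (Nat.choose_pos hj).ne'
  have n2 : (j.choose k : ℝ≥0∞) ≠ 0 := by exact_mod_cast (Nat.choose_pos hkj).ne'
  have n3 : (M.choose k : ℝ≥0∞) ≠ 0 := by exact_mod_cast (Nat.choose_pos (hkj.trans hj)).ne'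
  have t1 := ENNReal.natCast_ne_top (M.choose j)
  have t2 := ENNReal.natCast_ne_top (j.choose k)
  have t3 := ENNReal.natCast_ne_top (M.choose k)
  have : (M.choose j : ℝ≥0∞)⁻¹ * (j.choose k : ℝ≥0∞)⁻¹ * ((M - k).choose (j - k) : ℕ)
      = (M.choose k : ℝ≥0∞)⁻¹ := by
    rw [← ENNReal.mul_inv (.inl n1) (.inl t1), hch,
      ENNReal.mul_inv (.inl n3) (.inl t3), mul_assoc, ENNReal.inv_mul_cancel, mul_one]
    · exact_mod_cast (Nat.choose_pos (Nat.sub_le_sub_right hj k)).ne'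
    · exact ENNReal.natCast_ne_top _
  rw [← this]; ring

/-! ### Mixtures of estimators and random thinning -/

lemma measurable_sum_smul_measure {α β ι : Type*} [MeasurableSpace α] [MeasurableSpace β]
    (J : Finset ι) (b : ι → ℝ≥0∞) (K : ι → α → Measure β) (hK : ∀ j, Measurable (K j)) :
    Measurable fun s => ∑ j ∈ J, b j • K j s := by
  refine Measure.measurable_of_measurable_coe _ fun t ht => ?_
  simp only [Measure.finsetSum_apply, Measure.smul_apply, smul_eq_mul]
  exact Finset.measurable_fun_sum _ fun j _ =>
    ((Measure.measurable_coe ht).comp (hK j)).const_mul (b j)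

/-- A finite mixture of kernels. -/
noncomputable def mixKernel {α β ι : Type*} [MeasurableSpace α] [MeasurableSpace β]
    (J : Finset ι) (b : ι → ℝ≥0∞) (K : ι → Kernel α β) : Kernel α β where
  toFun s := ∑ j ∈ J, b j • K j s
  measurable' := measurable_sum_smul_measure J b (fun j => K j) fun j => (K j).measurable

lemma isMarkovKernel_mixKernel {α β ι : Type*} [MeasurableSpace α] [MeasurableSpace β]
    (J : Finset ι) (b : ι → ℝ≥0∞) (K : ι → Kernel α β) (hK : ∀ j, IsMarkovKernel (K j))
    (hb : ∑ j ∈ J, b j = 1) : IsMarkovKernel (mixKernel J b K) := by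
  refine ⟨fun s => ⟨?_⟩⟩
  simp [mixKernel, Measure.finsetSum_apply, hb]

lemma lintegral_mixKernel {α β ι : Type*} [MeasurableSpace α] [MeasurableSpace β]
    (J : Finset ι) (b : ι → ℝ≥0∞) (K : ι → Kernel α β) (f : β → ℝ≥0∞) (s : α) :
    ∫⁻ a, f a ∂mixKernel J b K s = ∑ j ∈ J, b j * ∫⁻ a, f a ∂K j s := by
  simp [mixKernel, lintegral_finsetSum_measure]

section Thinning

variable {ι X Y A : Type*} [Fintype ι] [DecidableEq ι] [MeasurableSpace X] [MeasurableSpace Y]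
  [Zero Y] [MeasurableSpace A]

/-- The estimator that erases uniformly chosen labels until `k` of them are left, and then applies
`κ`. If there are fewer than `k` labels, it applies `κ` to the original data. -/
noncomputable def thinKernel (k : ℕ) (κ : Kernel (ι → Obs X Y) A) : Kernel (ι → Obs X Y) A where
  toFun s := if k ≤ (labels s).card then
      ∑ e ∈ Finset.powersetCard k (labels s),
        ((labels s).card.choose k : ℝ≥0∞)⁻¹ • κ (eraseLabels e s)
    else κ s
  measurable' := by
    -- There are finitely many label sets, so measurability may be checked with the label set frozen
    -- at each `d`.
    let _ : MeasurableSpace (Finset ι) := ⊤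
    refine (measurable_from_prod_countable_right
      (f := fun x : Finset ι × (ι → Obs X Y) => if k ≤ x.1.card then
        ∑ e ∈ Finset.powersetCard k x.1, (x.1.card.choose k : ℝ≥0∞)⁻¹ • κ (eraseLabels e x.2)
        else κ x.2) fun d => ?_).comp (measurable_labels.prodMk measurable_id)
    by_cases h : k ≤ d.card <;> simp only [h, if_true, if_false]
    · exact measurable_sum_smul_measure _ (fun _ => (d.card.choose k : ℝ≥0∞)⁻¹)
        (fun e s => κ (eraseLabels e s)) fun e => κ.measurable.comp (measurable_eraseLabels e)
    · exact κ.measurable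

instance (k : ℕ) (κ : Kernel (ι → Obs X Y) A) [IsMarkovKernel κ] :
    IsMarkovKernel (thinKernel k κ) := by
  refine ⟨fun s => ⟨?_⟩⟩
  by_cases h : k ≤ (labels s).card
  · have n1 : ((labels s).card.choose k : ℝ≥0∞) ≠ 0 := by exact_mod_cast (Nat.choose_pos h).ne'
    simp [thinKernel, h, Measure.finsetSum_apply, Finset.card_powersetCard,
      ENNReal.mul_inv_cancel n1]
  · simp [thinKernel, h]

/-- The risk of `κ` for the loss `f`, when the set of labeled indices is `d`. -/
noncomputable def labeledRisk (Q : Measure (X × Y)) (f : A → ℝ≥0∞) (κ : Kernel (ι → Obs X Y) A)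
    (d : Finset ι) : ℝ≥0∞ :=
  ∫⁻ s, ∫⁻ a, f a ∂κ s ∂labeledLaw Q d

lemma labeledRisk_thinKernel (Q : Measure (X × Y)) [IsProbabilityMeasure Q] {f : A → ℝ≥0∞}
    (hf : Measurable f) (κ : Kernel (ι → Obs X Y) A) {k : ℕ} {d : Finset ι} (h : k ≤ d.card) :
    labeledRisk Q f (thinKernel k κ) d
      = ∑ e ∈ Finset.powersetCard k d, (d.card.choose k : ℝ≥0∞)⁻¹ * labeledRisk Q f κ e := by
  have hg : Measurable fun s => ∫⁻ a, f a ∂κ s := hf.lintegral_kernel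
  calc labeledRisk Q f (thinKernel k κ) d
      = ∫⁻ s, ∑ e ∈ Finset.powersetCard k d, (d.card.choose k : ℝ≥0∞)⁻¹ *
          ∫⁻ a, f a ∂κ (eraseLabels e s) ∂labeledLaw Q d := by
        refine lintegral_congr_ae ?_
        filter_upwards [labels_ae Q d] with s hs
        simp [thinKernel, hs, h, lintegral_finsetSum_measure]
    _ = _ := by
        have hm (e : Finset ι) : Measurable fun s => ∫⁻ a, f a ∂κ (eraseLabels e s) :=
          hg.comp (measurable_eraseLabels e)
        rw [lintegral_finsetSum _ fun e _ => (hm e).const_mul _]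
        refine Finset.sum_congr rfl fun e he => ?_
        rw [lintegral_const_mul _ (hm e), labeledRisk,
          ← map_eraseLabels Q (Finset.mem_powersetCard.1 he).1,
          lintegral_map hg (measurable_eraseLabels e)]

/-- The exact risk transfer from `k` to `j ≥ k` labels on which both comparisons rest. -/
lemma levelAvg_thinKernel (Q : Measure (X × Y)) [IsProbabilityMeasure Q] {f : A → ℝ≥0∞}
    (hf : Measurable f) (κ : Kernel (ι → Obs X Y) A) {j k : ℕ} (hkj : k ≤ j)
    (hj : j ≤ Fintype.card ι) :
    levelAvg (labeledRisk Q f (thinKernel k κ)) j = levelAvg (labeledRisk Q f κ) k := by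
  rw [← levelAvg_levelAvg_subset (labeledRisk Q f κ) hkj hj]
  unfold levelAvg
  congr 1
  refine Finset.sum_congr rfl fun d hd => labeledRisk_thinKernel Q hf κ ?_
  rwa [(Finset.mem_powersetCard.1 hd).2]

lemma levelAvg_mixKernel (Q : Measure (X × Y)) {f : A → ℝ≥0∞} (hf : Measurable f)
    (J : Finset ℕ) (b : ℕ → ℝ≥0∞) (K : ℕ → Kernel (ι → Obs X Y) A) (k : ℕ) :
    levelAvg (labeledRisk Q f (mixKernel J b K)) k
      = ∑ j ∈ J, b j * levelAvg (labeledRisk Q f (K j)) k := by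
  have h (d : Finset ι) : labeledRisk Q f (mixKernel J b K) d
      = ∑ j ∈ J, b j * labeledRisk Q f (K j) d := by
    simp only [labeledRisk, lintegral_mixKernel]
    rw [lintegral_finsetSum _ fun j _ => (hf.lintegral_kernel).const_mul _]
    exact Finset.sum_congr rfl fun j _ => lintegral_const_mul _ hf.lintegral_kernel
  simp only [levelAvg, h]
  rw [Finset.sum_comm, Finset.mul_sum]
  refine Finset.sum_congr rfl fun j _ => ?_
  rw [← Finset.mul_sum, mul_left_comm]

end Thinning

lemma levelAvg_one {ι : Type*} [Fintype ι] {k : ℕ} (hk : k ≤ Fintype.card ι) :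
    levelAvg (fun _ : Finset ι => 1) k = 1 := by
  have n1 : ((Fintype.card ι).choose k : ℝ≥0∞) ≠ 0 := by exact_mod_cast (Nat.choose_pos hk).ne'
  simp [levelAvg, ENNReal.inv_mul_cancel n1]

/-! ### Integrals under random and conditioned numbers of labels -/

section RandomN

variable {X Y : Type*} [MeasurableSpace X] [MeasurableSpace Y] [Zero Y]

/-- The probability that `k` of the `n + m` observations are labeled. -/
noncomputable def countMass (n m k : ℕ) : ℝ≥0∞ :=
  ENNReal.ofReal (binomialMass (n + m) (labelProb n m) k)

lemma countMass_eq (n m k : ℕ) : countMass n m k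
    = (n + m).choose k * (labelMass n m ^ k * unlabelMass n m ^ (n + m - k)) := by
  have h0 : 0 ≤ (labelProb n m : ℝ) := (labelProb n m).2.1
  have h1 : 0 ≤ 1 - (labelProb n m : ℝ) := sub_nonneg.2 (labelProb n m).2.2
  have e1 : labelMass n m = ENNReal.ofReal (labelProb n m) := by
    rw [ENNReal.ofReal_eq_coe_nnreal h0]; rfl
  have e2 : unlabelMass n m = ENNReal.ofReal (1 - labelProb n m) := by
    rw [ENNReal.ofReal_eq_coe_nnreal h1]; rfl
  rw [e1, e2, countMass, binomialMass, ENNReal.ofReal_mul (by positivity),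
    ENNReal.ofReal_mul (by positivity), ENNReal.ofReal_natCast, ENNReal.ofReal_pow h0,
    ENNReal.ofReal_pow h1]

lemma setLIntegral_randomNLaw (n m : ℕ) (Q : Measure (X × Y)) [IsProbabilityMeasure Q]
    (S : Set ℕ) [DecidablePred (· ∈ S)] (g : Sample n m X Y → ℝ≥0∞) :
    ∫⁻ s in {s | numLabeled s ∈ S}, g s ∂randomNLaw n m Q
      = ∑ k ∈ Finset.range (n + m + 1) with k ∈ S,
        countMass n m k * levelAvg (fun d => ∫⁻ s, g s ∂labeledLaw Q d) k := by
  have hS : MeasurableSet {s : Sample n m X Y | numLabeled s ∈ S} := by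
    simp only [numLabeled_eq]
    exact measurableSet_labels_mem {d | d.card ∈ S}
  have h (d : Finset (Fin (n + m))) :
      ∫⁻ s in {s | numLabeled s ∈ S}, g s ∂labeledLaw Q d
        = if d.card ∈ S then ∫⁻ s, g s ∂labeledLaw Q d else 0 := by
    split_ifs with hd
    · congr 1
      refine Measure.restrict_eq_self_of_ae_mem ?_
      filter_upwards [labels_ae Q d] with s hs
      rwa [numLabeled_eq, hs]
    · have : (labeledLaw Q d) {s : Sample n m X Y | numLabeled s ∈ S} = 0 := by
        refine measure_eq_zero_iff_ae_notMem.2 ?_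
        filter_upwards [labels_ae Q d] with s hs
        rwa [numLabeled_eq, hs]
      exact setLIntegral_measure_zero _ _ this
  rw [randomNLaw_eq, ← Measure.restrictₗ_apply, map_sum, lintegral_finsetSum_measure]
  simp only [Measure.restrictₗ_apply, Measure.restrict_smul, lintegral_smul_measure, h, smul_eq_mul]
  -- The mixture weights depend only on `d.card`, so the sum is grouped by cardinality.
  rw [← Finset.powerset_univ, Finset.sum_powerset, Finset.card_univ, Fintype.card_fin,
    Finset.sum_filter]
  refine Finset.sum_congr rfl fun k hk => ?_
  have hk : k ≤ n + m := by simpa [Nat.lt_succ_iff] using hk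
  have n1 : ((n + m).choose k : ℝ≥0∞) ≠ 0 := by exact_mod_cast (Nat.choose_pos hk).ne'
  rw [countMass_eq, levelAvg, Fintype.card_fin]
  rw [mul_comm ((n + m).choose k : ℝ≥0∞), mul_assoc,
    ENNReal.mul_inv_cancel_left n1 (ENNReal.natCast_ne_top _), Finset.mul_sum]
  split_ifs with hkS
  · refine Finset.sum_congr rfl fun d hd => ?_
    rw [(Finset.mem_powersetCard.1 hd).2, if_pos hkS]
  · refine Finset.sum_eq_zero fun d hd => ?_
    rw [(Finset.mem_powersetCard.1 hd).2, if_neg hkS, mul_zero]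

lemma lintegral_randomNLaw (n m : ℕ) (Q : Measure (X × Y)) [IsProbabilityMeasure Q]
    (g : Sample n m X Y → ℝ≥0∞) :
    ∫⁻ s, g s ∂randomNLaw n m Q = ∑ k ∈ Finset.range (n + m + 1),
      countMass n m k * levelAvg (fun d => ∫⁻ s, g s ∂labeledLaw Q d) k := by
  classical
  simpa using setLIntegral_randomNLaw n m Q Set.univ g

lemma randomNLaw_numLabeled_mem (n m : ℕ) (Q : Measure (X × Y)) [IsProbabilityMeasure Q]
    (S : Set ℕ) [DecidablePred (· ∈ S)] :
    randomNLaw n m Q {s | numLabeled s ∈ S}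
      = ∑ k ∈ Finset.range (n + m + 1) with k ∈ S, countMass n m k := by
  rw [← setLIntegral_one, setLIntegral_randomNLaw]
  refine Finset.sum_congr rfl fun k hk => ?_
  have hk : k ≤ n + m := by simpa [Nat.lt_succ_iff] using (Finset.mem_filter.1 hk).1
  simp only [lintegral_const, measure_univ, mul_one]
  rw [levelAvg_one (by simpa using hk), mul_one]

lemma countMass_pos {n m k : ℕ} (hn : 0 < n) (hm : 0 < m) (hk : k ≤ n + m) :
    0 < countMass n m k := by
  have h1 : 0 < 1 - (n : ℝ) / (n + m) := by
    rw [sub_pos, div_lt_one (by positivity)]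
    have : (0 : ℝ) < m := by exact_mod_cast hm
    linarith
  have := Nat.choose_pos hk
  refine ENNReal.ofReal_pos.2 ?_
  unfold binomialMass
  change 0 < ((n + m).choose k : ℝ) * ((n / (n + m) : ℝ) ^ k * (1 - n / (n + m)) ^ (n + m - k))
  positivity

/-- All `k`-sets carry equal weight, so conditioning leaves the uniform average. Dividing by
`countMass n m k` is legitimate because the labeling probability lies strictly between 0 and 1. -/
lemma lintegral_condNLaw {n m k : ℕ} (hn : 0 < n) (hm : 0 < m) (hk : k ≤ n + m)
    (Q : Measure (X × Y)) [IsProbabilityMeasure Q] (g : Sample n m X Y → ℝ≥0∞) :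
    ∫⁻ s, g s ∂condNLaw n m k Q = levelAvg (fun d => ∫⁻ s, g s ∂labeledLaw Q d) k := by
  classical
  have hf : {j ∈ Finset.range (n + m + 1) | j ∈ ({k} : Set ℕ)} = {k} := by
    ext j; simp only [Finset.mem_filter, Finset.mem_range, Set.mem_singleton_iff,
      Finset.mem_singleton]; omega
  have h1 := setLIntegral_randomNLaw n m Q {k} g
  have h2 := randomNLaw_numLabeled_mem n m Q {k}
  rw [hf, Finset.sum_singleton] at h1 h2
  simp only [Set.mem_singleton_iff] at h1 h2
  rw [condNLaw, ProbabilityTheory.cond, lintegral_smul_measure, h1, h2, smul_eq_mul,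
    ENNReal.inv_mul_cancel_left (countMass_pos hn hm hk).ne' ENNReal.ofReal_ne_top]

lemma sum_countMass (n m : ℕ) (S : Finset ℕ) :
    ∑ k ∈ S, countMass n m k
      = ENNReal.ofReal (∑ k ∈ S, binomialMass (n + m) (labelProb n m) k) :=
  (ENNReal.ofReal_sum_of_nonneg fun k _ =>
    binomialMass_nonneg (labelProb n m).2.1 (labelProb n m).2.2 k).symm

end RandomN

/-! ### Cauchy-Schwarz and the minimax risk -/

lemma setLIntegral_le_sqrt_mul_sqrt {α : Type*} [MeasurableSpace α] (μ : Measure α)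
    {g : α → ℝ≥0∞} (hg : Measurable g) (S : Set α) :
    ∫⁻ x in S, g x ∂μ ≤ (∫⁻ x, g x ^ 2 ∂μ) ^ (1 / 2 : ℝ) * μ S ^ (1 / 2 : ℝ) := by
  have h := ENNReal.lintegral_mul_le_Lp_mul_Lq (μ.restrict S) Real.HolderConjugate.two_two
    hg.aemeasurable (g := fun _ => 1) aemeasurable_const
  simp only [Pi.mul_apply, mul_one, ENNReal.rpow_two, one_pow, lintegral_one, Measure.restrict_apply_univ] at h
  refine h.trans ?_
  gcongr
  exact Measure.restrict_le_self

lemma lintegral_sq_le {α : Type*} [MeasurableSpace α] (μ : Measure α) [IsProbabilityMeasure μ]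
    {g : α → ℝ≥0∞} (hg : Measurable g) : (∫⁻ x, g x ∂μ) ^ 2 ≤ ∫⁻ x, g x ^ 2 ∂μ := by
  have h := setLIntegral_le_sqrt_mul_sqrt μ hg Set.univ
  rw [Measure.restrict_univ, measure_univ, ENNReal.one_rpow, mul_one] at h
  calc (∫⁻ x, g x ∂μ) ^ 2 ≤ ((∫⁻ x, g x ^ 2 ∂μ) ^ (1 / 2 : ℝ)) ^ 2 := by gcongr
    _ = ∫⁻ x, g x ^ 2 ∂μ := by
      rw [← ENNReal.rpow_two, ← ENNReal.rpow_mul]; norm_num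

lemma minimax_eq {Θ D A : Type*} [MeasurableSpace D] [MeasurableSpace A] {L : A → Θ → ℝ}
    (hL : ∀ θ, Measurable fun a => L a θ) (P : Θ → Measure D) :
    minimax L P = ⨅ (κ : Kernel D A) (_ : IsMarkovKernel κ),
      ⨆ θ, ∫⁻ s, ∫⁻ a, ENNReal.ofReal (L a θ) ∂κ s ∂P θ := by
  let _ : MeasurableSpace Θ := ⊤
  unfold minimax minimaxRisk
  refine iInf_congr fun κ => iInf_congr fun _ => iSup_congr fun θ => ?_
  exact Kernel.lintegral_comp κ (familyKernel P) θ (hL θ).ennreal_ofReal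

/-- Cauchy-Schwarz is used twice: over the data, to split off the event `S`, and over the
randomization of `κ`, to move the square inside. -/
lemma lintegral_le_supRootMeanSq {Θ D A : Type*} [MeasurableSpace D] [MeasurableSpace A]
    {L : A → Θ → ℝ} (hL0 : ∀ a θ, 0 ≤ L a θ) (hL : ∀ θ, Measurable fun a => L a θ)
    (P : Θ → Measure D) (κ : Kernel D A) [hκ : IsMarkovKernel κ] (θ : Θ) (S : Set D) :
    ∫⁻ s in S, ∫⁻ a, ENNReal.ofReal (L a θ) ∂κ s ∂P θ
      ≤ supRootMeanSq L P * P θ S ^ (1 / 2 : ℝ) := by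
  have hm := (hL θ).ennreal_ofReal
  refine (setLIntegral_le_sqrt_mul_sqrt (P θ) hm.lintegral_kernel S).trans ?_
  gcongr
  refine le_trans ?_ (le_iSup₂_of_le κ hκ (le_iSup
    (fun θ => (∫⁻ s, ∫⁻ a, ENNReal.ofReal (L a θ ^ 2) ∂(κ s) ∂(P θ)) ^ (1 / 2 : ℝ)) θ))
  gcongr with s
  refine (lintegral_sq_le (κ s) hm).trans_eq ?_
  simp only [ENNReal.ofReal_pow (hL0 _ θ)]

/-! ### Tails of the number of labels at distance `n ^ q` from its mean -/

lemma labelProb_mul {n m : ℕ} (hn : 0 < n) : ((n + m : ℕ) : ℝ) * (labelProb n m : ℝ) = n := by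
  change ((n + m : ℕ) : ℝ) * ((n : ℝ) / (n + m)) = n
  push_cast
  field_simp

lemma sq_rpow_div {x : ℝ} (hx : 0 < x) (q c : ℝ) :
    (x ^ q) ^ 2 / (c * x) = x ^ (2 * q - 1) / c := by
  rw [Real.rpow_sub_one hx.ne', mul_comm 2 q, Real.rpow_mul hx.le, Real.rpow_two]
  rw [mul_comm c, div_div]

/-- With overwhelming probability at least `⌊n - n ^ q + 1⌋` observations are labeled. -/
lemma sum_countMass_lt_le {n m : ℕ} (hn : 0 < n) {q : ℝ} (hq1 : q < 1) :
    ∑ k ∈ Finset.range (n + m + 1) with k < ⌊(n : ℝ) - (n : ℝ) ^ q + 1⌋₊, countMass n m k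
      ≤ ENNReal.ofReal (Real.exp (-(n : ℝ) ^ (2 * q - 1) / 2)) := by
  have hn0 : (0 : ℝ) < n := by exact_mod_cast hn
  have hn1 : (1 : ℝ) ≤ n := by exact_mod_cast hn
  have ht : (n : ℝ) ^ q ≤ n := by simpa using Real.rpow_le_rpow_of_exponent_le hn1 hq1.le
  rw [sum_countMass]
  refine ENNReal.ofReal_le_ofReal ((binomialMass_lower_tail (labelProb n m).2.1
    (labelProb n m).2.2 hn0 (labelProb_mul hn) (t := (n : ℝ) ^ q) (by positivity) _
    fun k hk => ?_).trans_eq ?_)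
  -- The `+ 1` inside the floor cancels the one gained from the strict inequality, leaving `k ≤ n -
  -- n ^ q`.
  · have h1 : (k : ℝ) + 1 ≤ ⌊(n : ℝ) - (n : ℝ) ^ q + 1⌋₊ := by exact_mod_cast hk
    have h2 := Nat.floor_le (a := (n : ℝ) - (n : ℝ) ^ q + 1) (by linarith)
    linarith
  · rw [sq_rpow_div hn0, neg_div]

/-- With overwhelming probability at most `⌊n + n ^ q⌋` observations are labeled. -/
lemma le_sum_countMass {n m : ℕ} (hn : 0 < n) {q : ℝ} (hq1 : q < 1)
    (hk : ⌊(n : ℝ) + (n : ℝ) ^ q⌋₊ ≤ n + m) :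
    ENNReal.ofReal (1 - Real.exp (-(n : ℝ) ^ (2 * q - 1) / 4))
      ≤ ∑ k ∈ Finset.range (⌊(n : ℝ) + (n : ℝ) ^ q⌋₊ + 1), countMass n m k := by
  have hn0 : (0 : ℝ) < n := by exact_mod_cast hn
  have hn1 : (1 : ℝ) ≤ n := by exact_mod_cast hn
  have ht : (n : ℝ) ^ q ≤ n := by simpa using Real.rpow_le_rpow_of_exponent_le hn1 hq1.le
  rw [sum_countMass]
  set K := ⌊(n : ℝ) + (n : ℝ) ^ q⌋₊ with hK
  refine ENNReal.ofReal_le_ofReal ?_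
  have htail := binomialMass_upper_tail (labelProb n m).2.1
    (labelProb n m).2.2 hn0 (labelProb_mul hn) (t := (n : ℝ) ^ q) (by positivity) ht (K < ·)
    fun k hk => by
      have h1 : (K : ℝ) + 1 ≤ k := by exact_mod_cast hk
      have h2 := Nat.lt_floor_add_one ((n : ℝ) + (n : ℝ) ^ q)
      linarith
  rw [sq_rpow_div hn0, ← neg_div] at htail
  have hsum := Finset.sum_filter_add_sum_filter_not (Finset.range (n + m + 1)) (K < ·)
    (binomialMass (n + m) (labelProb n m))
  rw [sum_binomialMass] at hsum
  have hset : {k ∈ Finset.range (n + m + 1) | ¬ K < k} = Finset.range (K + 1) := by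
    ext j; simp only [Finset.mem_filter, Finset.mem_range]; omega
  rw [hset] at hsum
  linarith

/-! ### Comparison of the minimax risks -/

section Comparison

variable {X Y Θ A : Type*} [MeasurableSpace X] [MeasurableSpace Y] [Zero Y] [MeasurableSpace A]
  {n m : ℕ} {Q : Θ → Measure (X × Y)} {L : A → Θ → ℝ}

/-- An estimator for random `N` yields one for `N = k`, by erasing labels at random. -/
lemma minimax_condNLaw_mul_le (hn : 0 < n) (hm : 0 < m) (hQ : ∀ θ, IsProbabilityMeasure (Q θ))
    (hL : ∀ θ, Measurable fun a => L a θ) {k : ℕ} (hk : k ≤ n + m) :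
    minimax L (fun θ => condNLaw n m k (Q θ)) * ∑ j ∈ Finset.range (k + 1), countMass n m j
      ≤ minimax L (fun θ => randomNLaw n m (Q θ)) := by
  set T := ∑ j ∈ Finset.range (k + 1), countMass n m j with hT
  have hT0 : T ≠ 0 := by
    refine (lt_of_lt_of_le (countMass_pos hn hm hk) ?_).ne'
    exact Finset.single_le_sum (f := countMass n m) (fun _ _ => zero_le)
      (Finset.self_mem_range_succ k)
  have hTt : T ≠ ⊤ := by rw [hT, sum_countMass]; exact ENNReal.ofReal_ne_top
  rw [minimax_eq hL, minimax_eq hL]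
  refine le_iInf₂ fun κ hκ => ?_
  -- The number `j` of labels to keep has the law of `N` conditioned on `N ≤ k`.
  let κ' := mixKernel (Finset.range (k + 1)) (fun j => countMass n m j * T⁻¹)
    fun j => thinKernel j κ
  have hκ' : IsMarkovKernel κ' := isMarkovKernel_mixKernel _ _ _ (fun j => inferInstance)
    (by rw [← Finset.sum_mul, ENNReal.mul_inv_cancel hT0 hTt])
  refine (mul_le_mul_left (iInf₂_le κ' hκ') T).trans ?_
  rw [ENNReal.iSup_mul]
  refine iSup_mono fun θ => ?_
  have hf := (hL θ).ennreal_ofReal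
  rw [lintegral_condNLaw hn hm hk, lintegral_randomNLaw]
  change levelAvg (labeledRisk (Q θ) (fun a => ENNReal.ofReal (L a θ)) κ') k * T ≤
    ∑ j ∈ Finset.range (n + m + 1), countMass n m j *
      levelAvg (labeledRisk (Q θ) (fun a => ENNReal.ofReal (L a θ)) κ) j
  rw [levelAvg_mixKernel _ hf, Finset.sum_mul]
  calc _ = ∑ j ∈ Finset.range (k + 1), countMass n m j *
        levelAvg (labeledRisk (Q θ) (fun a => ENNReal.ofReal (L a θ)) κ) j := by
        refine Finset.sum_congr rfl fun j hj => ?_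
        rw [levelAvg_thinKernel _ hf κ (Nat.lt_succ_iff.1 (Finset.mem_range.1 hj)) (by simpa),
          mul_right_comm, mul_assoc (countMass n m j), ENNReal.inv_mul_cancel hT0 hTt, mul_one]
    -- The discarded levels `j > k` contribute nonnegative risk.
    _ ≤ _ := Finset.sum_le_sum_of_subset (Finset.range_mono (by omega))

/-- An estimator for `N = k` yields one for random `N`, by erasing labels at random if there are
more than `k` of them. -/
lemma minimax_randomNLaw_le (hn : 0 < n) (hm : 0 < m) (hQ : ∀ θ, IsProbabilityMeasure (Q θ))
    (hL0 : ∀ a θ, 0 ≤ L a θ) (hL : ∀ θ, Measurable fun a => L a θ) {k : ℕ} (hk : k ≤ n + m) :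
    minimax L (fun θ => randomNLaw n m (Q θ)) ≤ minimax L (fun θ => condNLaw n m k (Q θ)) +
      supRootMeanSq L (fun θ => randomNLaw n m (Q θ)) *
        (∑ j ∈ Finset.range (n + m + 1) with j < k, countMass n m j) ^ (1 / 2 : ℝ) := by
  rw [minimax_eq hL, minimax_eq hL]
  simp only [ENNReal.iInf_add]
  refine le_iInf₂ fun κ hκ => iInf₂_le_of_le (thinKernel k κ) inferInstance ?_
  refine iSup_le fun θ => ?_
  have hf := (hL θ).ennreal_ofReal
  have hmeas : MeasurableSet {s : Sample n m X Y | numLabeled s ∈ Set.Iio k} := by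
    simp only [numLabeled_eq]
    exact measurableSet_labels_mem {d | d.card ∈ Set.Iio k}
  rw [← lintegral_add_compl _ hmeas, add_comm]
  refine add_le_add ?_ ?_
  · refine le_trans ?_ (le_iSup (fun θ =>
      ∫⁻ s, ∫⁻ a, ENNReal.ofReal (L a θ) ∂κ s ∂condNLaw n m k (Q θ)) θ)
    rw [lintegral_condNLaw hn hm hk]
    change ∫⁻ s in {s : Sample n m X Y | numLabeled s ∈ (Set.Iio k)ᶜ}, _ ∂_ ≤
      levelAvg (labeledRisk (Q θ) (fun a => ENNReal.ofReal (L a θ)) κ) k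
    classical
    rw [setLIntegral_randomNLaw]
    -- On each level `j ≥ k` the thinned estimator has the level-`k` risk of `κ`, and these levels
    -- have total mass at most 1.
    calc _ = ∑ j ∈ Finset.range (n + m + 1) with j ∈ (Set.Iio k)ᶜ, countMass n m j *
          levelAvg (labeledRisk (Q θ) (fun a => ENNReal.ofReal (L a θ)) κ) k := by
          refine Finset.sum_congr rfl fun j hj => ?_
          simp only [Finset.mem_filter, Finset.mem_range, Set.mem_compl_iff, Set.mem_Iio,
            not_lt] at hj
          rw [← levelAvg_thinKernel _ hf κ hj.2 (by simpa using Nat.lt_succ_iff.1 hj.1)]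
          rfl
      _ ≤ 1 * _ := by
          rw [← Finset.sum_mul, ← randomNLaw_numLabeled_mem n m (Q θ)]
          gcongr
          exact prob_le_one
      _ = _ := one_mul _
  · refine (lintegral_le_supRootMeanSq hL0 hL
      (fun θ => randomNLaw n m (Q θ)) (thinKernel k κ) θ _).trans_eq ?_
    rw [randomNLaw_numLabeled_mem n m (Q θ) (Set.Iio k)]
    rfl

end Comparison

theorem mainTheorem11 {X Y Θ A : Type*} [MeasurableSpace X] [MeasurableSpace Y] [Zero Y]
    [TopologicalSpace A] [T2Space A] [LocallyCompactSpace A] [SecondCountableTopology A]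
    [MeasurableSpace A] [BorelSpace A]
    (n m : ℕ) (hn : 0 < n) (hm : 0 < m)
    (Q : Θ → Measure (X × Y)) (hQ : ∀ θ, IsProbabilityMeasure (Q θ))
    (hdom : IsDominated fun θ => obsLaw n m (Q θ))
    (L : A → Θ → ℝ) (hL0 : ∀ a θ, 0 ≤ L a θ)
    (hLc : ∀ (θ : Θ) (c : ℝ), IsCompact {a | L a θ ≤ c})
    (q : ℝ) (hq : 1 / 2 < q) (hq1 : q < 1) :
    (⌊(n : ℝ) + (n : ℝ) ^ q⌋₊ ≤ n + m →
      minimax L (fun θ => condNLaw n m ⌊(n : ℝ) + (n : ℝ) ^ q⌋₊ (Q θ)) *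
          ENNReal.ofReal (1 - Real.exp (-(n : ℝ) ^ (2 * q - 1) / 4)) ≤
        minimax L (fun θ => randomNLaw n m (Q θ))) ∧
    minimax L (fun θ => randomNLaw n m (Q θ)) ≤
      minimax L (fun θ => condNLaw n m ⌊(n : ℝ) - (n : ℝ) ^ q + 1⌋₊ (Q θ)) +
        (supRootMeanSq L (fun θ => randomNLaw n m (Q θ)) + 1) *
          ENNReal.ofReal (Real.exp (-(n : ℝ) ^ (2 * q - 1) / 4)) := by
  -- Compact sublevel sets are closed in a Hausdorff space, hence Borel.
  have hL (θ : Θ) : Measurable fun a => L a θ :=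
    measurable_of_Iic fun c => (hLc θ c).isClosed.measurableSet
  refine ⟨fun hk => ?_, ?_⟩
  · refine le_trans ?_ (minimax_condNLaw_mul_le hn hm hQ hL hk)
    gcongr
    exact le_sum_countMass hn hq1 hk
  · have hn1 : (1 : ℝ) ≤ n := by exact_mod_cast hn
    have hk : ⌊(n : ℝ) - (n : ℝ) ^ q + 1⌋₊ ≤ n + m := by
      have : (1 : ℝ) ≤ (n : ℝ) ^ q := Real.one_le_rpow hn1 (by linarith)
      refine (Nat.floor_le_floor (show _ ≤ (n : ℝ) by linarith)).trans ?_
      rw [Nat.floor_natCast]; omega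
    refine (minimax_randomNLaw_le hn hm hQ hL0 hL hk).trans ?_
    gcongr
    · exact le_self_add
    -- The square root from Cauchy-Schwarz turns the tail exponent with denominator 2 into the one
    -- with denominator 4.
    · refine (ENNReal.rpow_le_rpow (sum_countMass_lt_le hn hq1) (by norm_num)).trans_eq ?_
      rw [ENNReal.ofReal_rpow_of_pos (Real.exp_pos _), ← Real.exp_mul]
      ring_nf
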